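/- **Theorem (matchings on locally treelike graphs).** For a finite simple graph $G=(V,E)$ whose edges arrive one at a time in an arbitrary fixed order $e_1,\dots,e_m$ (each edge of $G$ exactly once), and a real parameter $C$, let $\textsc{Matching}(G,C)$ be the following randomized online algorithm. Initially the matching $M$ is empty, all vertices are unmatched, and $d_w=0$ for every vertex $w$. When the edge $(u,v)$ arrives: if $u$ and $v$ are both unmatched, draw a fresh independent uniform $R\in[0,1]$, and if $R\le \frac{C}{(C-d_u)(C-d_v)}$, add $(u,v)$ to $M$ and mark $u$ and $v$ as matched; then (in all cases) increase $d_u$ and $d_v$ by $1$. Let $\delta\in(0,1/20)$, let $\Delta\ge 25$ and $g\ge 0$ be integers, and let $C>\left(\frac{e}{e-1}+\delta\right)\Delta$ (here $e$ is Euler's number). Let $G$ have maximum degree at most $\Delta$, and let $f$ be an edge of $G$ whose $g$-neighborhood contains no cycle, i.e. the subgraph of $G$ induced by the vertices within distance $g$ of an endpoint of $f$ is acyclic. Then, for every arrival order of the edges, the final matching of $\textsc{Matching}(G,C)$ contains $f$ with probability at least $$\frac1C\left(\max\left\{0,\; 1-\left(1-\frac{\delta}{4}\right)^{(g-1)/2}-\frac{10^4}{\delta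 C}\right\}\right)^2 .$$ -/

import Mathlib

namespace OnlineMatching

open MeasureTheory

/-- The two outcomes of the test `R ≤ p` exhaust the probability space of a uniform `R`. -/
theorem sum_test_eq_one (p : ℝ) :
    ∑ b : Bool, (volume : Measure unitInterval) {R : unitInterval | decide ((R : ℝ) ≤ p) = b} = 1 := by
  have hm : MeasurableSet {R : unitInterval | (R : ℝ) ≤ p} :=
    measurableSet_le measurable_subtype_coe measurable_const
  have h := prob_add_prob_compl (μ := (volume : Measure unitInterval)) hm
  have e1 : {R : unitInterval | decide ((R : ℝ) ≤ p) = true} = {R : unitInterval | (R : ℝ) ≤ p} := by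
    ext R; simp
  have e2 : {R : unitInterval | decide ((R : ℝ) ≤ p) = false} = {R : unitInterval | (R : ℝ) ≤ p}ᶜ := by
    ext R; simp
  rw [Fintype.sum_bool, e1, e2, h]

/-- The law of the outcome of the test `R ≤ p`, where `R` is drawn uniformly from `[0,1]`. -/
noncomputable def uniformTest (p : ℝ) : PMF Bool :=
  PMF.ofFintype (fun b => (volume : Measure unitInterval) {R : unitInterval | decide ((R : ℝ) ≤ p) = b})
    (sum_test_eq_one p)

theorem uniformTest_true {p : ℝ} (h0 : 0 ≤ p) (h1 : p ≤ 1) :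
    uniformTest p true = ENNReal.ofReal p := by
  have e : {R : unitInterval | decide ((R : ℝ) ≤ p) = true} = Set.Iic ⟨p, h0, h1⟩ := by
    ext R
    simp only [decide_eq_true_eq, Set.mem_ofPred_eq, Set.mem_Iic, ← Subtype.coe_le_coe]
  rw [uniformTest, PMF.ofFintype_apply, e, unitInterval.volume_Iic]

/-- The variables of the online matching algorithm. -/
structure State (V : Type*) where
  /-- the current set of matched edges -/
  matching : Finset (Sym2 V)
  /-- the current degree of each vertex -/
  deg : V → ℕ
  /-- records whether a vertex is currently matched -/
  matched : V → Bool

/-- The initial state: no edge is matched, no edge has arrived. -/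
def State.init (V : Type*) : State V where
  matching := ∅
  deg := fun _ => 0
  matched := fun _ => false

/-- Add the edge `f` to the matching and mark its endpoints as matched. -/
def State.addEdge {V : Type*} [DecidableEq V] (s : State V) (f : Sym2 V) : State V where
  matching := insert f s.matching
  deg := s.deg
  matched := fun w => if w ∈ f.toFinset then true else s.matched w

/-- Increase the current degree of both endpoints of `f` by one. -/
def State.incDeg {V : Type*} [DecidableEq V] (s : State V) (f : Sym2 V) : State V where
  matching := s.matching
  deg := fun w => if w ∈ f.toFinset then s.deg w + 1 else s.deg w
  matched := s.matched

/-- One step of the algorithm with parameter `C`: the edge `f = s(u, v)` arrives. If both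
endpoints are unmatched, a fresh uniform `R` is drawn from `[0,1]` and `f` is matched if
`R ≤ C / ((C - d_u) * (C - d_v))`. Then the degrees of both endpoints are increased. -/
noncomputable def arrive {V : Type*} [DecidableEq V] (C : ℝ) (f : Sym2 V) (s : State V) : PMF (State V) :=
  (if ∀ w ∈ f.toFinset, s.matched w = false then
      (uniformTest (C / ∏ w ∈ f.toFinset, (C - (s.deg w : ℝ)))).map
        (fun b => if b then s.addEdge f else s)
    else PMF.pure s).map (fun s' => s'.incDeg f)

/-- The law of the final state, when the edges in the list arrive in this order, starting from
the state `s`. -/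
noncomputable def run {V : Type*} [DecidableEq V] (C : ℝ) : List (Sym2 V) → State V → PMF (State V)
  | [], s => PMF.pure s
  | f :: fs, s => (arrive C f s).bind (run C fs)

/-- The law of the matching that the algorithm outputs with parameter `C` when the edges in the
list `es` arrive in this order. -/
noncomputable def outputLaw {V : Type*} [DecidableEq V] (C : ℝ) (es : List (Sym2 V)) : PMF (Finset (Sym2 V)) :=
  (run C es (State.init V)).map State.matching

/-- The probability that the algorithm includes the edge `e` in its final matching. -/
noncomputable def matchProb {V : Type*} [DecidableEq V] (C : ℝ) (es : List (Sym2 V)) (e : Sym2 V) : ℝ :=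
  ((outputLaw C es).toOuterMeasure {M | e ∈ M}).toReal

/-- The `g`-neighborhood of an edge `e`: the vertices within distance `g` of an endpoint of `e`.
The extended distance `edist` is infinite between different components. -/
def edgeNeighborhood {W : Type*} (G : SimpleGraph W) (g : ℕ) (e : Sym2 W) : Set W :=
  {w | ∃ x ∈ e, G.edist x w ≤ (g : ℕ∞)}

end OnlineMatching

namespace OnlineMatching

open MeasureTheory ProbabilityTheory

/-! The degrees in the test for an edge depend only on the arrival order, so the algorithm can be
driven by independent coins, one per edge, tossed in advance (`run_eq_coinLaw`). A vertex u is then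
unmatched after t steps iff no earlier edge uw had a successful coin while w was unmatched on its
arrival. This recursion reverses inclusions. Cut off at depth k with everything counted as matched
at depth 0, it gives lower bounds at even depth and upper bounds at odd depth
(`freeApprox_sandwich`), and depth k sees only edges within distance k.

If the neighborhood is acyclic, an arriving edge uw joins two different components of the past, so
the truncated events at u and w depend on disjoint sets of coins. Hence the exact recursion P(k+1,
t+1, u) = P(k+1, t, u) (1 - p P(k, t, w)) of `freeProb_add_one`. The test probability p is chosen so
that P = 1 - d/C solves the recursion without truncation, where d is the current degree.

It remains to see that the truncation error contracts. Let γ bound log(C/(C-Δ)). A relative deficit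
ε at depth k becomes an excess of at most η = exp(γε) - 1 at depth k+1. At depth k+2 the deficit is
at most 1 - exp(-γη(1 + η/(C-Δ))), which is at most γε + 4/(C-Δ) when 0 ≤ γ, ε ≤ 1. At C = eΔ/(e-1)
the logarithm equals 1; the margin δ allows γ = 1 - δ/4. So g/2 double steps leave the deficit (1 -
δ/4)^(g/2) + 10^4/(δC). Finally f is matched if its coin succeeds and both endpoints are free, three
independent events, and p (1 - d_u/C)(1 - d_v/C) = 1/C. -/

/-- The law of independent coins, where the coin `i` is the outcome of the test `R ≤ p i`. -/
noncomputable def coinLaw {ι : Type*} [Fintype ι] (p : ι → ℝ) : Measure (ι → Bool) :=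
  Measure.pi fun i => (uniformTest (p i)).toMeasure

instance {ι : Type*} [Fintype ι] (p : ι → ℝ) : IsProbabilityMeasure (coinLaw p) := by
  unfold coinLaw; infer_instance

theorem coinLaw_coin {ι : Type*} [Fintype ι] (p : ι → ℝ) (i : ι) (b : Bool) :
    coinLaw p {ω | ω i = b} = uniformTest (p i) b := by
  have h := (measurePreserving_eval (fun i => (uniformTest (p i)).toMeasure) i).measure_preimage
    (s := {b}) (MeasurableSet.of_discrete.nullMeasurableSet)
  rw [PMF.toMeasure_apply_singleton _ _ (MeasurableSet.singleton b)] at h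
  exact h

/-- Events that depend on disjoint sets of coins are independent. -/
theorem coinLaw_inter {ι : Type*} [Fintype ι] (p : ι → ℝ) {S T : Set ι} (hST : Disjoint S T)
    {A B : (ι → Bool) → Prop} (hA : DependsOn A S) (hB : DependsOn B T) :
    coinLaw p {ω | A ω ∧ B ω} = coinLaw p {ω | A ω} * coinLaw p {ω | B ω} := by
  classical
  have hi : iIndepFun (fun (i : ι) (ω : ι → Bool) => ω i) (coinLaw p) :=
    iIndepFun_pi (X := fun _ => id) (fun _ => measurable_id.aemeasurable)
  have hf := hi.indepFun_finset S.toFinset T.toFinset (by simpa using hST)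
    (fun i => measurable_pi_apply i)
  -- An event determined by the coins in `R` is a preimage under restriction to `R`; the value
  -- `false` given to the other coins is arbitrary.
  have key : ∀ (R : Set ι) (D : (ι → Bool) → Prop), DependsOn D R →
      {ω | D ω} = (fun (ω : ι → Bool) (i : R.toFinset) => ω i) ⁻¹'
        {x | D fun i => if h : i ∈ R.toFinset then x ⟨i, h⟩ else false} := by
    intro R D hD
    ext ω
    have : D ω = D (fun i => if h : i ∈ R.toFinset then ω i else false) := by
      apply hD
      intro i hi
      simp [hi]
    simp only [Set.mem_ofPred_eq, Set.mem_preimage]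
    rw [this]
  have h := hf.measure_inter_preimage_eq_mul
    {x | A fun i => if h : i ∈ S.toFinset then x ⟨i, h⟩ else false}
    {x | B fun i => if h : i ∈ T.toFinset then x ⟨i, h⟩ else false}
    MeasurableSet.of_discrete MeasurableSet.of_discrete
  rw [← key S A hA, ← key T B hB] at h
  exact h

/-! ### The algorithm driven by coins tossed in advance -/

section
variable {V : Type*} [DecidableEq V]

/-- One step of the algorithm, with the outcomes of all tests given in advance. -/
def detArrive (ω : Sym2 V → Bool) (f : Sym2 V) (s : State V) : State V :=
  (if (∀ w ∈ f.toFinset, s.matched w = false) ∧ ω f = true then s.addEdge f else s).incDeg f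

/-- The final state of the algorithm, with the outcomes of all tests given in advance. -/
def detRun (ω : Sym2 V → Bool) (fs : List (Sym2 V)) (s : State V) : State V :=
  fs.foldl (fun s f => detArrive ω f s) s

theorem detRun_dependsOn (fs : List (Sym2 V)) (s : State V) :
    DependsOn (fun ω => detRun ω fs s) {f | f ∈ fs} := by
  intro ω ω' h
  show detRun ω fs s = detRun ω' fs s
  induction fs generalizing s with
  | nil => rfl
  | cons f fs ih =>
    simp only [detRun, List.foldl_cons] at ih ⊢
    have : detArrive ω f s = detArrive ω' f s := by
      unfold detArrive
      rw [h f (by simp)]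
    rw [this]
    exact ih _ fun i hi => h i (by simp_all)

/-- The number of edges of `es` at `w` among the first `t`. -/
def degAt (es : List (Sym2 V)) (w : V) (t : ℕ) : ℕ := (es.take t).countP (fun f => w ∈ f)

/-- The probability of success of the test made for `f`. -/
noncomputable def testProb (C : ℝ) (es : List (Sym2 V)) (f : Sym2 V) : ℝ :=
  C / ∏ w ∈ f.toFinset, (C - (degAt es w (es.idxOf f) : ℝ))

/-- Tossing a coin that is never consulted does not change the law. The prefix `pre` of edges
already processed is carried along so that the degrees in the state agree with those in `testProb`.
-/
theorem run_eq_coinLaw [Fintype V] (C : ℝ) (es : List (Sym2 V)) (hes : es.Nodup) (T : Set (State V))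
    (pre fs : List (Sym2 V)) (hpre : es = pre ++ fs) (s : State V)
    (hs : ∀ w, s.deg w = pre.countP (fun f => w ∈ f)) :
    (run C fs s).toOuterMeasure T = coinLaw (testProb C es) {ω | detRun ω fs s ∈ T} := by
  induction fs generalizing pre s with
  | nil =>
    by_cases h : s ∈ T <;> simp [run, detRun, h]
  | cons f fs ih =>
    have hdeg : ∀ s' : State V, s'.deg = s.deg → ∀ w, (s'.incDeg f).deg w
        = (pre ++ [f]).countP (fun f => w ∈ f) := by
      intro s' hs' w
      by_cases hw : w ∈ f <;> simp [State.incDeg, hs', hs, hw]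
    have hih : ∀ s' : State V, s'.deg = s.deg → (run C fs (s'.incDeg f)).toOuterMeasure T =
        coinLaw (testProb C es) {ω | detRun ω fs (s'.incDeg f) ∈ T} := fun s' hs' =>
      ih (pre ++ [f]) (by simp [hpre]) _ (hdeg s' hs')
    by_cases hfree : ∀ w ∈ f.toFinset, s.matched w = false
    · have hidx : es.idxOf f = pre.length := by
        have hnot : f ∉ pre := by
          rw [hpre] at hes
          intro hf
          exact (List.nodup_append.1 hes).2.2 f hf f (by simp) rfl
        rw [hpre, List.idxOf_append_of_notMem hnot]; simp
      have hp : C / ∏ w ∈ f.toFinset, (C - (s.deg w : ℝ)) = testProb C es f := by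
        unfold testProb degAt
        rw [hidx, hpre, List.take_left]
        simp [hs]
      -- No edge arrives twice, so the rest of the run never consults the coin of `f` and is
      -- independent of it.
      have hfs : f ∉ fs := by
        rw [hpre] at hes
        exact (List.nodup_cons.1 (List.nodup_append.1 hes).2.1).1
      have hstep : ∀ b : Bool, coinLaw (testProb C es)
          {ω | ω f = b ∧ detRun ω (f :: fs) s ∈ T} = uniformTest (testProb C es f) b *
          (run C fs ((if b then s.addEdge f else s).incDeg f)).toOuterMeasure T := by
        intro b
        rw [hih _ (by cases b <;> rfl), ← coinLaw_coin, ← coinLaw_inter (S := {f}) (T := {g | g ∈ fs})]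
        · congr 1
          ext ω
          simp only [Set.mem_ofPred_eq]
          refine and_congr_right fun hb => ?_
          have : detArrive ω f s = (if b then s.addEdge f else s).incDeg f := by
            unfold detArrive
            rw [hb]
            cases b
            · simp
            · rw [if_pos ⟨hfree, rfl⟩, if_pos rfl]
          simp only [detRun, List.foldl_cons, this]
        · simpa using hfs
        · intro x y h
          simp [h f rfl]
        · intro x y h
          have := detRun_dependsOn fs ((if b then s.addEdge f else s).incDeg f) h
          simp only at this
          simp [this]
      have hsplit : coinLaw (testProb C es) {ω | detRun ω (f :: fs) s ∈ T} =
          coinLaw (testProb C es) {ω | ω f = true ∧ detRun ω (f :: fs) s ∈ T} +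
          coinLaw (testProb C es) {ω | ω f = false ∧ detRun ω (f :: fs) s ∈ T} := by
        rw [← measure_union _ MeasurableSet.of_discrete]
        · congr 1
          ext ω
          cases h : ω f <;> simp [h]
        · rw [Set.disjoint_left]
          rintro ω ⟨h1, -⟩ ⟨h2, -⟩
          simp [h1] at h2
      rw [hsplit, hstep, hstep]
      simp only [run, arrive, if_pos hfree, hp]
      rw [PMF.map_comp, PMF.bind_map, PMF.toOuterMeasure_bind_apply, tsum_bool, add_comm]
      simp
    · have hd : ∀ ω, detRun ω (f :: fs) s = detRun ω fs (s.incDeg f) := by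
        intro ω
        simp only [detRun, List.foldl_cons, detArrive]
        rw [if_neg (fun h => hfree h.1)]
      simp only [run, arrive, if_neg hfree, PMF.pure_map, PMF.pure_bind, hd]
      exact hih s rfl

theorem matchProb_eq [Fintype V] (C : ℝ) (es : List (Sym2 V)) (hes : es.Nodup) (e : Sym2 V) :
    matchProb C es e =
      (coinLaw (testProb C es)).real {ω | e ∈ (detRun ω es (State.init V)).matching} := by
  unfold matchProb outputLaw Measure.real
  rw [PMF.toOuterMeasure_map_apply, run_eq_coinLaw C es hes _ [] es rfl _ (by simp [State.init])]
  rfl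

end

/-! ### The truncated recursion for being unmatched -/

section
variable {V : Type*}

/-- The depth `k` truncation of the recursion for the event that the vertex is unmatched after
the first `t` edges of `es`, where vertices at depth `0` count as matched. -/
def freeApprox (es : List (Sym2 V)) (ω : Sym2 V → Bool) : ℕ → ℕ → V → Prop
  | 0, _, _ => False
  | k + 1, t, u => ∀ s < t, ∀ w, es[s]? = some s(u, w) →
      ¬ (ω s(u, w) = true ∧ freeApprox es ω k s w)

theorem freeApprox_add_one (es : List (Sym2 V)) (ω : Sym2 V → Bool) (k t : ℕ) (u : V) :
    freeApprox es ω (k + 1) (t + 1) u ↔ freeApprox es ω (k + 1) t u ∧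
      ∀ w, es[t]? = some s(u, w) → ¬ (ω s(u, w) = true ∧ freeApprox es ω k t w) := by
  simp only [freeApprox, Nat.lt_succ_iff_lt_or_eq]
  constructor
  · intro h
    exact ⟨fun s hs => h s (Or.inl hs), h t (Or.inr rfl)⟩
  · rintro ⟨h1, h2⟩ s (hs | rfl)
    · exact h1 s hs
    · exact h2

/-- The state after the first `t` edges. -/
def stateAt [DecidableEq V] (es : List (Sym2 V)) (ω : Sym2 V → Bool) (t : ℕ) : State V :=
  detRun ω (es.take t) (State.init V)

theorem stateAt_add_one [DecidableEq V] (es : List (Sym2 V)) (ω : Sym2 V → Bool) {t : ℕ} {f : Sym2 V}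
    (h : es[t]? = some f) : stateAt es ω (t + 1) = detArrive ω f (stateAt es ω t) := by
  simp [stateAt, List.take_add_one, h, detRun]

theorem stateAt_add_one_of_none [DecidableEq V] (es : List (Sym2 V)) (ω : Sym2 V → Bool) {t : ℕ}
    (h : es[t]? = none) : stateAt es ω (t + 1) = stateAt es ω t := by
  simp [stateAt, List.take_add_one, h]

theorem matched_stateAt_add_one [DecidableEq V] (es : List (Sym2 V)) (ω : Sym2 V → Bool) (t : ℕ) (u : V) :
    (stateAt es ω (t + 1)).matched u = false ↔ (stateAt es ω t).matched u = false ∧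
      ∀ w, es[t]? = some s(u, w) →
        ¬ (ω s(u, w) = true ∧ (stateAt es ω t).matched w = false) := by
  rcases hf : es[t]? with _ | f
  · simp [stateAt_add_one_of_none es ω hf]
  · rw [stateAt_add_one es ω hf]
    set s := stateAt es ω t
    by_cases hu : u ∈ f
    · obtain ⟨w, rfl⟩ := Sym2.mem_iff_exists.1 hu
      by_cases h : (∀ x ∈ (s(u, w) : Sym2 V).toFinset, s.matched x = false) ∧ ω s(u, w) = true
      · have hw := h.1 w (by simp)
        simp only [detArrive, if_pos h]
        simp [State.incDeg, State.addEdge, h.2, hw]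
      · simp only [detArrive, if_neg h]
        simp only [Sym2.mem_toFinset, Sym2.mem_iff, forall_eq_or_imp, forall_eq] at h
        simp only [State.incDeg, Option.some.injEq, Sym2.congr_right]
        constructor
        · rintro h1
          refine ⟨h1, ?_⟩
          rintro _ rfl ⟨h2, h3⟩
          exact h ⟨⟨h1, h3⟩, h2⟩
        · exact fun h => h.1
    · have : ∀ w, f ≠ s(u, w) := by
        rintro w rfl
        simp at hu
      simp only [Option.some.injEq, this, false_imp_iff, implies_true, and_true]
      by_cases h : (∀ x ∈ f.toFinset, s.matched x = false) ∧ ω f = true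
      · simp only [detArrive, if_pos h]
        simp [State.incDeg, State.addEdge, hu]
      · simp only [detArrive, if_neg h]
        simp [State.incDeg]

/-- There is no need to ask that `u` be free at time `s`: if it is not, it is already matched, and
otherwise this edge matches it. -/
theorem matched_stateAt_iff [DecidableEq V] (es : List (Sym2 V)) (ω : Sym2 V → Bool) (t : ℕ) (u : V) :
    (stateAt es ω t).matched u = false ↔ ∀ s < t, ∀ w, es[s]? = some s(u, w) →
      ¬ (ω s(u, w) = true ∧ (stateAt es ω s).matched w = false) := by
  induction t with
  | zero => simp [stateAt, detRun, State.init]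
  | succ t ih =>
    rw [matched_stateAt_add_one, ih]
    simp only [Nat.lt_succ_iff_lt_or_eq]
    constructor
    · rintro ⟨h1, h2⟩ s (hs | rfl)
      · exact h1 s hs
      · exact h2
    · intro h
      exact ⟨fun s hs => h s (Or.inl hs), h t (Or.inr rfl)⟩

/-- The truncations of even and odd depth are lower and upper bounds for the event that a vertex
is unmatched. -/
theorem freeApprox_sandwich [DecidableEq V] (es : List (Sym2 V)) (ω : Sym2 V → Bool) (k : ℕ) :
    (∀ t u, freeApprox es ω (2 * k) t u → (stateAt es ω t).matched u = false) ∧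
    (∀ t u, (stateAt es ω t).matched u = false → freeApprox es ω (2 * k + 1) t u) := by
  -- The recursion is antitone in the events at the neighbors, so each further level turns a lower
  -- bound into an upper bound and conversely.
  have step : ∀ k, (∀ t u, freeApprox es ω k t u → (stateAt es ω t).matched u = false) →
      (∀ t u, (stateAt es ω t).matched u = false → freeApprox es ω (k + 1) t u) := by
    intro k hk t u h s hs w hw hc
    exact (matched_stateAt_iff es ω t u).1 h s hs w hw ⟨hc.1, hk _ _ hc.2⟩
  have step' : ∀ k, (∀ t u, (stateAt es ω t).matched u = false → freeApprox es ω k t u) →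
      (∀ t u, freeApprox es ω (k + 1) t u → (stateAt es ω t).matched u = false) := by
    intro k hk t u h
    rw [matched_stateAt_iff]
    intro s hs w hw hc
    exact h s hs w hw ⟨hc.1, hk _ _ hc.2⟩
  induction k with
  | zero =>
    have h0 : ∀ t u, freeApprox es ω 0 t u → (stateAt es ω t).matched u = false :=
      fun _ _ h => h.elim
    exact ⟨h0, step 0 h0⟩
  | succ k ih => exact ⟨step' _ ih.2, step _ (step' _ ih.2)⟩

theorem mem_matching_mono [DecidableEq V] (ω : Sym2 V → Bool) (fs : List (Sym2 V)) (s : State V) (e : Sym2 V)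
    (h : e ∈ s.matching) : e ∈ (detRun ω fs s).matching := by
  induction fs generalizing s with
  | nil => exact h
  | cons f fs ih =>
    refine ih (detArrive ω f s) ?_
    unfold detArrive
    split_ifs
    · exact Finset.mem_insert_of_mem h
    · exact h

theorem mem_matching_of_freeApprox [DecidableEq V] (es : List (Sym2 V)) (ω : Sym2 V → Bool) (k t : ℕ) {u v : V}
    (ht : es[t]? = some s(u, v)) (hω : ω s(u, v) = true) (hu : freeApprox es ω (2 * k) t u)
    (hv : freeApprox es ω (2 * k) t v) :
    s(u, v) ∈ (detRun ω es (State.init V)).matching := by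
  have h1 : s(u, v) ∈ (stateAt es ω (t + 1)).matching := by
    have hfree : (∀ x ∈ (s(u, v) : Sym2 V).toFinset, (stateAt es ω t).matched x = false) ∧
        ω s(u, v) = true := by
      refine ⟨?_, hω⟩
      have := (freeApprox_sandwich es ω k).1
      simp [this _ _ hu, this _ _ hv]
    rw [stateAt_add_one es ω ht, detArrive, if_pos hfree]
    exact Finset.mem_insert_self _ _
  have h2 : detRun ω es (State.init V) = detRun ω (es.drop (t + 1)) (stateAt es ω (t + 1)) := by
    rw [stateAt, detRun, detRun, detRun, ← List.foldl_append, List.take_append_drop]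
  rw [h2]
  exact mem_matching_mono ω _ _ _ h1

/-! ### Locality and disjointness of the coins that matter -/

/-- The graph of the first `t` edges of `es`, restricted to `B`. -/
def pastGraph (es : List (Sym2 V)) (B : Set V) (t : ℕ) : SimpleGraph V :=
  SimpleGraph.fromEdgeSet {f | f ∈ es.take t ∧ ∀ x ∈ f, x ∈ B}

theorem pastGraph_mono (es : List (Sym2 V)) (B : Set V) {s t : ℕ} (h : s ≤ t) :
    pastGraph es B s ≤ pastGraph es B t := by
  apply SimpleGraph.fromEdgeSet_mono
  rintro f ⟨h1, h2⟩
  exact ⟨List.take_subset_take_left _ h h1, h2⟩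

/-- The edges in the connected component of `u` in the graph of the first `t` edges. -/
def pastComponent (es : List (Sym2 V)) (B : Set V) (t : ℕ) (u : V) : Set (Sym2 V) :=
  {f | f ∈ (pastGraph es B t).edgeSet ∧ ∃ a ∈ f, (pastGraph es B t).Reachable u a}

theorem pastComponent_disjoint {es : List (Sym2 V)} {B : Set V} {t : ℕ} {u w : V}
    (h : ¬ (pastGraph es B t).Reachable u w) :
    Disjoint (pastComponent es B t u) (pastComponent es B t w) := by
  rw [Set.disjoint_left]
  rintro f ⟨hf, a, ha, hua⟩ ⟨-, b, hb, hwb⟩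
  apply h
  refine hua.trans (SimpleGraph.Reachable.trans ?_ hwb.symm)
  by_cases hab : a = b
  · rw [hab]
  · have : f = s(a, b) := (Sym2.mem_and_mem_iff hab).1 ⟨ha, hb⟩
    rw [this] at hf
    exact SimpleGraph.Adj.reachable hf

theorem notMem_pastComponent {es : List (Sym2 V)} (hes : es.Nodup) {B : Set V} {t : ℕ}
    {f : Sym2 V} (ht : es[t]? = some f) (u : V) : f ∉ pastComponent es B t u := by
  rintro ⟨hf, -⟩
  rw [pastGraph, SimpleGraph.edgeSet_fromEdgeSet] at hf
  obtain ⟨i, hi, h⟩ := List.mem_take_iff_getElem.1 hf.1.1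
  obtain ⟨h1, h2⟩ := List.getElem?_eq_some_iff.1 ht
  have := (hes.getElem_inj_iff (hi := by omega) (hj := h1)).1 (h.trans h2.symm)
  omega

/-- Every edge of a forest is a bridge, and the past does not contain the edge that is just
arriving, so its two ends are not yet connected. -/
theorem not_reachable_pastGraph {G : SimpleGraph V} {es : List (Sym2 V)} (hes : es.Nodup)
    (hG : ∀ f, f ∈ es ↔ f ∈ G.edgeSet) {B : Set V} (hB : (G.induce B).IsAcyclic) {t : ℕ} {u w : V}
    (ht : es[t]? = some s(u, w)) (hu : u ∈ B) (hw : w ∈ B) :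
    ¬ (pastGraph es B t).Reachable u w := by
  have hadj : (G.induce B).Adj ⟨u, hu⟩ ⟨w, hw⟩ := by
    have := (hG s(u, w)).1 (List.mem_of_getElem? ht)
    simpa using this
  have hbr := (SimpleGraph.isAcyclic_iff_forall_adj_isBridge.1 hB) hadj
  rw [SimpleGraph.isBridge_iff] at hbr
  -- A walk in the past graph stays in `B` and avoids `s(u, w)`, hence lifts to the induced forest
  -- with this edge deleted.
  have key : ∀ {a b : V} (_ : (pastGraph es B t).Walk a b) (ha : a ∈ B), ∃ hb : b ∈ B,
      ((G.induce B).deleteEdges {s(⟨u, hu⟩, ⟨w, hw⟩)}).Reachable ⟨a, ha⟩ ⟨b, hb⟩ := by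
    intro a b p
    induction p with
    | nil => exact fun ha => ⟨ha, SimpleGraph.Reachable.refl _⟩
    | @cons a b c hab p ih =>
      intro ha
      rw [pastGraph, SimpleGraph.fromEdgeSet_adj] at hab
      obtain ⟨hb, h⟩ : ∃ hb : b ∈ B, _ := ⟨hab.1.2 b (by simp), ih (hab.1.2 b (by simp))⟩
      obtain ⟨hc, h⟩ := h
      refine ⟨hc, SimpleGraph.Reachable.trans (SimpleGraph.Adj.reachable ?_) h⟩
      rw [SimpleGraph.deleteEdges_adj]
      refine ⟨?_, ?_⟩
      · simpa using (hG s(a, b)).1 (List.mem_of_mem_take hab.1.1)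
      · intro heq
        have heq' : s(a, b) = s(u, w) := by
          have := congrArg (Sym2.map Subtype.val) (Set.mem_singleton_iff.1 heq)
          simpa using this
        have hmem : s(u, w) ∈ es.take t := heq' ▸ hab.1.1
        obtain ⟨i, hi, h⟩ := List.mem_take_iff_getElem.1 hmem
        obtain ⟨h1, h2⟩ := List.getElem?_eq_some_iff.1 ht
        have := (hes.getElem_inj_iff (hi := by omega) (hj := h1)).1 (h.trans h2.symm)
        omega
  rintro ⟨p⟩
  obtain ⟨_, h⟩ := key p hu
  exact hbr h

theorem edgeNeighborhood_adj {G : SimpleGraph V} {j : ℕ} {e : Sym2 V} {u w : V}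
    (h : G.Adj u w) (hu : u ∈ edgeNeighborhood G j e) : w ∈ edgeNeighborhood G (j + 1) e := by
  obtain ⟨x, hx, hxu⟩ := hu
  refine ⟨x, hx, (SimpleGraph.edist_triangle (v := u)).trans ?_⟩
  push_cast
  exact add_le_add hxu (SimpleGraph.edist_le_one_iff_adj_or_eq.2 (Or.inl h))

theorem edgeNeighborhood_mono {G : SimpleGraph V} {j k : ℕ} (h : j ≤ k) {e : Sym2 V} :
    edgeNeighborhood G j e ⊆ edgeNeighborhood G k e := by
  rintro u ⟨x, hx, hxu⟩
  exact ⟨x, hx, hxu.trans (by exact_mod_cast h)⟩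

theorem mem_edgeNeighborhood_zero {G : SimpleGraph V} {e : Sym2 V} {u : V} (h : u ∈ e) :
    u ∈ edgeNeighborhood G 0 e := ⟨u, h, by simp⟩

/-- The truncation of depth `k` at `u` depends only on edges that are connected to `u` inside
the neighborhood. -/
theorem freeApprox_dependsOn {G : SimpleGraph V} {es : List (Sym2 V)}
    (hG : ∀ f, f ∈ es ↔ f ∈ G.edgeSet) {g : ℕ} {e : Sym2 V} (k : ℕ) :
    ∀ (j t : ℕ) (u : V), u ∈ edgeNeighborhood G j e → j + k ≤ g →
      DependsOn (fun ω => freeApprox es ω k t u)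
        (pastComponent es (edgeNeighborhood G g e) t u) := by
  induction k with
  | zero =>
    intro j t u _ _ ω ω' _
    rfl
  | succ k ih =>
    intro j t u hu hj ω ω' h
    simp only [freeApprox, eq_iff_iff]
    refine forall_congr' fun s => forall_congr' fun hs => forall_congr' fun w =>
      forall_congr' fun hw => not_congr ?_
    have hadj : G.Adj u w := by
      have := (hG s(u, w)).1 (List.mem_of_getElem? hw)
      simpa using this
    have hwB := edgeNeighborhood_adj hadj hu
    have hpast : (pastGraph es (edgeNeighborhood G g e) t).Adj u w := by
      rw [pastGraph, SimpleGraph.fromEdgeSet_adj]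
      refine ⟨⟨?_, ?_⟩, hadj.ne⟩
      · obtain ⟨h1, h2⟩ := List.getElem?_eq_some_iff.1 hw
        exact List.mem_take_iff_getElem.2 ⟨s, by omega, h2⟩
      · intro x hx
        rcases Sym2.mem_iff.1 hx with rfl | rfl
        · exact edgeNeighborhood_mono (by omega) hu
        · exact edgeNeighborhood_mono (by omega) hwB
    have h1 : ω s(u, w) = ω' s(u, w) :=
      h _ ⟨hpast, u, by simp, SimpleGraph.Reachable.refl _⟩
    have h2 : freeApprox es ω k s w = freeApprox es ω' k s w := by
      refine ih (j + 1) s w hwB (by omega) fun f hf => h f ?_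
      obtain ⟨hf1, a, ha, hr⟩ := hf
      have hm := pastGraph_mono es (edgeNeighborhood G g e) hs.le
      exact ⟨SimpleGraph.edgeSet_mono hm hf1, a, ha, hpast.reachable.trans (hr.mono hm)⟩
    rw [h1, h2]

end

/-! ### The exact recursion for the truncated probabilities -/

theorem coinLaw_real_inter {ι : Type*} [Fintype ι] (p : ι → ℝ) {S T : Set ι} (hST : Disjoint S T)
    {A B : (ι → Bool) → Prop} (hA : DependsOn A S) (hB : DependsOn B T) :
    (coinLaw p).real {ω | A ω ∧ B ω} = (coinLaw p).real {ω | A ω} * (coinLaw p).real {ω | B ω} := by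
  simp only [Measure.real, coinLaw_inter p hST hA hB, ENNReal.toReal_mul]

theorem coinLaw_real_coin_and {ι : Type*} [Fintype ι] (p : ι → ℝ) {i : ι} (h0 : 0 ≤ p i)
    (h1 : p i ≤ 1) {T : Set ι} (hi : i ∉ T) {B : (ι → Bool) → Prop} (hB : DependsOn B T) :
    (coinLaw p).real {ω | ω i = true ∧ B ω} = p i * (coinLaw p).real {ω | B ω} := by
  have hX : DependsOn (fun ω : ι → Bool => ω i = true) {i} := by
    intro x y h
    simp [h i rfl]
  rw [coinLaw_real_inter p (by simpa using hi) hX hB]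
  congr 1
  rw [Measure.real, coinLaw_coin, uniformTest_true h0 h1, ENNReal.toReal_ofReal h0]

theorem coinLaw_real_and_not_coin {ι : Type*} [Fintype ι] (p : ι → ℝ) {i : ι} (h0 : 0 ≤ p i)
    (h1 : p i ≤ 1) {S T : Set ι} (hST : Disjoint S T) (hS : i ∉ S) (hT : i ∉ T)
    {A B : (ι → Bool) → Prop} (hA : DependsOn A S) (hB : DependsOn B T) :
    (coinLaw p).real {ω | A ω ∧ ¬ (ω i = true ∧ B ω)} =
      (coinLaw p).real {ω | A ω} * (1 - p i * (coinLaw p).real {ω | B ω}) := by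
  have hXB : DependsOn (fun ω : ι → Bool => ¬ (ω i = true ∧ B ω)) (insert i T) := by
    intro x y h
    have hB' : B x = B y := hB fun j hj => h j (Set.mem_insert_of_mem _ hj)
    simp [h i (Set.mem_insert _ _), hB']
  rw [coinLaw_real_inter p (Set.disjoint_insert_right.2 ⟨hS, hST⟩) hA hXB]
  congr 1
  rw [← coinLaw_real_coin_and p h0 h1 hT hB, ← probReal_compl_eq_one_sub MeasurableSet.of_discrete]
  rfl

/-- The standing assumptions: the edges of `G` arrive in the order `es`, the degrees are at most
`Δ`, the parameter `C` is so large that all the tests are made with probabilities, and the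
`g`-neighborhood of `e` is acyclic. -/
structure IsTreelike {V : Type*} [DecidableEq V] (G : SimpleGraph V) (es : List (Sym2 V))
    (Δ g : ℕ) (C : ℝ) (e : Sym2 V) : Prop where
  nodup : es.Nodup
  mem_iff : ∀ f, f ∈ es ↔ f ∈ G.edgeSet
  countP_le : ∀ u, es.countP (fun f => u ∈ f) ≤ Δ
  lt_param : (Δ : ℝ) + 4 ≤ C
  param_le : C ≤ (C - Δ) ^ 2
  acyclic : (G.induce (edgeNeighborhood G g e)).IsAcyclic

/-- The probability of the truncated event of depth `k` that `u` is unmatched after `t` edges. -/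
noncomputable def freeProb {V : Type*} [DecidableEq V] [Fintype V] (C : ℝ) (es : List (Sym2 V))
    (k t : ℕ) (u : V) : ℝ :=
  (coinLaw (testProb C es)).real {ω | freeApprox es ω k t u}

theorem degAt_add_one {V : Type*} [DecidableEq V] {es : List (Sym2 V)} {t : ℕ} {u w : V}
    (ht : es[t]? = some s(u, w)) : degAt es u (t + 1) = degAt es u t + 1 := by
  simp [degAt, List.take_add_one, ht]

theorem degAt_add_one_of_ne {V : Type*} [DecidableEq V] {es : List (Sym2 V)} {t : ℕ} {u : V}
    (ht : ∀ w, es[t]? ≠ some s(u, w)) : degAt es u (t + 1) = degAt es u t := by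
  rcases hf : es[t]? with _ | f
  · simp [degAt, List.take_add_one, hf]
  · have hu : u ∉ f := by
      intro hu
      obtain ⟨w, rfl⟩ := Sym2.mem_iff_exists.1 hu
      exact ht w hf
    simp [degAt, List.take_add_one, hf, hu]

section
variable {V : Type*} [DecidableEq V] {G : SimpleGraph V} {es : List (Sym2 V)}
  {Δ g : ℕ} {C : ℝ} {e : Sym2 V}

theorem le_sub_degAt {t : ℕ} {u : V}
    (ht : degAt es u t + 1 ≤ Δ) : C - Δ + 1 ≤ C - degAt es u t := by
  have : (degAt es u t : ℝ) + 1 ≤ Δ := by exact_mod_cast ht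
  linarith

namespace IsTreelike

theorem adj (h : IsTreelike G es Δ g C e) {t : ℕ} {u w : V} (ht : es[t]? = some s(u, w)) :
    G.Adj u w := by
  simpa using (h.mem_iff s(u, w)).1 (List.mem_of_getElem? ht)

theorem degAt_add_one_le (h : IsTreelike G es Δ g C e) {t : ℕ} {u w : V}
    (ht : es[t]? = some s(u, w)) : degAt es u t + 1 ≤ Δ := by
  rw [← degAt_add_one ht]
  exact ((List.take_sublist _ _).countP_le).trans (h.countP_le u)

theorem testProb_eq (h : IsTreelike G es Δ g C e) {t : ℕ} {u w : V} (ht : es[t]? = some s(u, w)) :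
    testProb C es s(u, w) = C / ((C - degAt es u t) * (C - degAt es w t)) := by
  have hidx : es.idxOf s(u, w) = t := by
    obtain ⟨h1, h2⟩ := List.getElem?_eq_some_iff.1 ht
    rw [← h2, h.nodup.idxOf_getElem]
  have : (s(u, w) : Sym2 V).toFinset = {u, w} := by
    ext x; simp
  rw [testProb, this, Finset.prod_pair (h.adj ht).ne, hidx]

theorem testProb_mem (h : IsTreelike G es Δ g C e) {t : ℕ} {u w : V}
    (ht : es[t]? = some s(u, w)) : 0 ≤ testProb C es s(u, w) ∧ testProb C es s(u, w) ≤ 1 := by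
  have h1 := le_sub_degAt (C := C) (h.degAt_add_one_le ht)
  have h2 := le_sub_degAt (C := C) (h.degAt_add_one_le (ht.trans (congrArg some Sym2.eq_swap)))
  have h3 := h.lt_param
  have h4 := h.param_le
  have h5 : (0 : ℝ) ≤ Δ := Nat.cast_nonneg _
  have hpos : 0 < (C - degAt es u t) * (C - degAt es w t) := mul_pos (by linarith) (by linarith)
  rw [h.testProb_eq ht]
  refine ⟨div_nonneg (by linarith) hpos.le, (div_le_one hpos).2 ?_⟩
  nlinarith

end IsTreelike

theorem freeProb_zero_right [Fintype V] (k : ℕ) (u : V) : freeProb C es (k + 1) 0 u = 1 := by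
  simp [freeProb, freeApprox]

theorem freeProb_add_one_of_ne [Fintype V] {k t : ℕ} {u : V} (ht : ∀ w, es[t]? ≠ some s(u, w)) :
    freeProb C es (k + 1) (t + 1) u = freeProb C es (k + 1) t u := by
  simp [freeProb, freeApprox_add_one, ht]

theorem freeProb_nonneg [Fintype V] (k t : ℕ) (u : V) : 0 ≤ freeProb C es k t u :=
  measureReal_nonneg

theorem freeProb_le_one [Fintype V] (k t : ℕ) (u : V) : freeProb C es k t u ≤ 1 :=
  measureReal_le_one

namespace IsTreelike

theorem not_reachable (h : IsTreelike G es Δ g C e) {t : ℕ} {u w : V}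
    (ht : es[t]? = some s(u, w)) {j : ℕ} (hj : j + 1 ≤ g) (hu : u ∈ edgeNeighborhood G j e) :
    ¬ (pastGraph es (edgeNeighborhood G g e) t).Reachable u w :=
  not_reachable_pastGraph h.nodup h.mem_iff h.acyclic ht (edgeNeighborhood_mono (by omega) hu)
    (edgeNeighborhood_mono hj (edgeNeighborhood_adj (h.adj ht) hu))

/-- The event at `u`, the coin of the arriving edge and the event at `w` depend on pairwise disjoint
sets of coins, so their probabilities multiply. The budget `j + (k + 1) ≤ g` keeps both events
within the acyclic neighborhood. -/
theorem freeProb_add_one [Fintype V] (h : IsTreelike G es Δ g C e) {k j t : ℕ} {u w : V}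
    (hu : u ∈ edgeNeighborhood G j e) (hj : j + (k + 1) ≤ g) (ht : es[t]? = some s(u, w)) :
    freeProb C es (k + 1) (t + 1) u =
      freeProb C es (k + 1) t u * (1 - testProb C es s(u, w) * freeProb C es k t w) := by
  have hw := edgeNeighborhood_adj (h.adj ht) hu
  have hp := h.testProb_mem ht
  rw [freeProb, freeProb, freeProb, ← coinLaw_real_and_not_coin (testProb C es) hp.1 hp.2
    (pastComponent_disjoint (h.not_reachable ht (by omega) hu))
    (notMem_pastComponent h.nodup ht u) (notMem_pastComponent h.nodup ht w)
    (freeApprox_dependsOn h.mem_iff (k + 1) j t u hu hj)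
    (freeApprox_dependsOn h.mem_iff k (j + 1) t w hw (by omega))]
  congr 1
  ext ω
  simp only [Set.mem_ofPred_eq, freeApprox_add_one, ht, Option.some.injEq, Sym2.congr_right]
  simp

/-- Even depth matters: only then does the truncated event guarantee that the endpoints really are
unmatched. -/
theorem le_matchProb [Fintype V] (h : IsTreelike G es Δ g C e) {k t : ℕ} {u w : V}
    (hk : 2 * k ≤ g) (ht : es[t]? = some s(u, w)) (he : e = s(u, w)) :
    testProb C es e * (freeProb C es (2 * k) t u * freeProb C es (2 * k) t w) ≤
      matchProb C es e := by
  have hu : u ∈ edgeNeighborhood G 0 e := mem_edgeNeighborhood_zero (by simp [he])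
  have hw : w ∈ edgeNeighborhood G 0 e := mem_edgeNeighborhood_zero (by simp [he])
  have hp := h.testProb_mem ht
  have hA := freeApprox_dependsOn (g := g) h.mem_iff (2 * k) 0 t u hu (by omega)
  have hB := freeApprox_dependsOn (g := g) h.mem_iff (2 * k) 0 t w hw (by omega)
  have hr := not_reachable_pastGraph h.nodup h.mem_iff h.acyclic ht
    (edgeNeighborhood_mono (Nat.zero_le g) hu) (edgeNeighborhood_mono (Nat.zero_le g) hw)
  have hAB : DependsOn (fun ω => freeApprox es ω (2 * k) t u ∧ freeApprox es ω (2 * k) t w)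
      (pastComponent es (edgeNeighborhood G g e) t u ∪
        pastComponent es (edgeNeighborhood G g e) t w) := by
    intro x y hxy
    have h1 := hA fun i hi => hxy i (Or.inl hi)
    have h2 := hB fun i hi => hxy i (Or.inr hi)
    simp only at h1 h2
    simp only [h1, h2]
  rw [matchProb_eq C es h.nodup, freeProb, freeProb,
    ← coinLaw_real_inter _ (pastComponent_disjoint hr) hA hB, he,
    ← coinLaw_real_coin_and _ hp.1 hp.2 _ hAB]
  · refine measureReal_mono ?_
    rintro ω ⟨h1, h2, h3⟩
    exact mem_matching_of_freeApprox es ω k t ht h1 h2 h3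
  · rintro (hc | hc)
    · exact notMem_pastComponent h.nodup ht u hc
    · exact notMem_pastComponent h.nodup ht w hc

end IsTreelike

end

/-! ### Elementary inequalities and propagation of the error -/

/-- Bounds the terms 1/(C-1-d) of the accumulated error by a telescoping sum of logarithms. -/
theorem inv_le_log_sub_log {y : ℝ} (hy : 1 < y) : 1 / y ≤ Real.log y - Real.log (y - 1) := by
  have h := Real.log_le_sub_one_of_pos (x := (y - 1) / y) (div_pos (by linarith) (by linarith))
  rw [Real.log_div (by linarith) (by linarith), sub_div, div_self (by linarith)] at h
  linarith

theorem exp_neg_le_one_sub {x : ℝ} (h0 : 0 ≤ x) (h1 : x ≤ 1 / 2) :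
    Real.exp (-(x * (1 + x))) ≤ 1 - x := by
  have h := Real.quadratic_le_exp_of_nonneg (x := x * (1 + x)) (by positivity)
  rw [Real.exp_neg, inv_le_comm₀ (Real.exp_pos _) (by linarith)]
  refine le_trans ?_ h
  rw [inv_le_iff_one_le_mul₀ (by linarith)]
  have h2 : 0 ≤ x ^ 2 * ((1 - x) * (1 + x) ^ 2 - 2 * x) := by
    refine mul_nonneg (sq_nonneg x) ?_
    nlinarith [mul_nonneg h0 (sub_nonneg.2 h1), mul_nonneg (mul_nonneg h0 h0) (sub_nonneg.2 h1)]
  nlinarith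

/-- Used at x = κε, where it says that an excess of exp(κε) - 1 costs, to first order in 1/C, a
deficit of at most κε one level later. -/
theorem one_sub_le_exp_one_sub_exp {x : ℝ} (hx : 0 ≤ x) :
    1 - x ≤ Real.exp (-(Real.exp x - 1)) := by
  have hd : ∀ y, HasDerivAt (fun y => (1 - y) * Real.exp (Real.exp y - 1))
      (-1 * Real.exp (Real.exp y - 1) + (1 - y) * (Real.exp (Real.exp y - 1) * Real.exp y)) y := by
    intro y
    have h1 : HasDerivAt (fun y : ℝ => 1 - y) (-1) y := (hasDerivAt_id y).const_sub 1
    exact h1.mul ((Real.hasDerivAt_exp y).sub_const 1).exp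
  -- The derivative has the sign of (1 - y) exp y - 1, and 1 - y ≤ exp(-y).
  have hanti : Antitone (fun y => (1 - y) * Real.exp (Real.exp y - 1)) := by
    refine antitone_of_deriv_nonpos (fun y => (hd y).differentiableAt) fun y => ?_
    rw [(hd y).deriv]
    have h1 : (1 - y) * Real.exp y ≤ 1 := by
      have := mul_le_mul_of_nonneg_right (Real.one_sub_le_exp_neg y) (Real.exp_pos y).le
      rwa [← Real.exp_add, neg_add_cancel, Real.exp_zero] at this
    nlinarith [Real.exp_pos (Real.exp y - 1)]
  have h := hanti hx
  simp only [Real.exp_zero, sub_self, sub_zero, mul_one] at h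
  rw [Real.exp_neg, ← one_div, le_div_iff₀ (Real.exp_pos _)]
  exact h

section
variable {V : Type*} [DecidableEq V] {G : SimpleGraph V} {es : List (Sym2 V)}
  {Δ g : ℕ} {C : ℝ} {e : Sym2 V}

/-- On edges within the neighborhood, the truncation of depth `k` underestimates the probability
`1 - d / C` by at most the factor `1 - ε`. -/
def LowerBound [Fintype V] (G : SimpleGraph V) (es : List (Sym2 V)) (Δ g : ℕ) (C : ℝ) (e : Sym2 V)
    (k : ℕ) (ε : ℝ) : Prop :=
  ∀ j t u, u ∈ edgeNeighborhood G j e → j + k ≤ g → degAt es u t + 1 ≤ Δ →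
    (1 - ε) * (1 - degAt es u t / C) ≤ freeProb C es k t u

/-- On edges within the neighborhood, the truncation of depth `k` overestimates the probability
`1 - d / C` by at most the factor `1 + η`. -/
def UpperBound [Fintype V] (G : SimpleGraph V) (es : List (Sym2 V)) (Δ g : ℕ) (C : ℝ) (e : Sym2 V)
    (k : ℕ) (η : ℝ) : Prop :=
  ∀ j t u, u ∈ edgeNeighborhood G j e → j + k ≤ g → degAt es u t + 1 ≤ Δ →
    freeProb C es k t u ≤ (1 + η) * (1 - degAt es u t / C)

theorem degAt_le_degAt_add_one (t : ℕ) (u : V) : degAt es u t ≤ degAt es u (t + 1) :=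
  (List.take_sublist_take_left (by omega)).countP_le

theorem log_sub_log_le {d : ℕ} {γ : ℝ} (hΔ : (Δ : ℝ) + 4 ≤ C) (hd : d + 1 ≤ Δ)
    (hγ : Real.log C - Real.log (C - Δ) ≤ γ) :
    Real.log (C - 1) - Real.log (C - 1 - d) ≤ γ := by
  have h1 : (d : ℝ) + 1 ≤ Δ := by exact_mod_cast hd
  have h2 : (0 : ℝ) ≤ d := Nat.cast_nonneg _
  have h3 := Real.log_le_log (x := C - 1) (y := C) (by linarith) (by linarith)
  have h4 := Real.log_le_log (x := C - Δ) (y := C - 1 - d) (by linarith) (by linarith)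
  linarith

namespace IsTreelike

/-- This cancellation is the reason for the form of the test: if `w` is free with probability `r`
times the ideal one, the degree of `w` disappears from the chance of losing `u`. -/
theorem testProb_mul (h : IsTreelike G es Δ g C e) {t : ℕ} {u w : V}
    (ht : es[t]? = some s(u, w)) (r : ℝ) :
    testProb C es s(u, w) * (r * (1 - degAt es w t / C)) = r / (C - degAt es u t) := by
  have h1 := le_sub_degAt (C := C) (h.degAt_add_one_le ht)
  have h2 := le_sub_degAt (C := C) (h.degAt_add_one_le (ht.trans (congrArg some Sym2.eq_swap)))
  have h3 := h.lt_param
  have h5 : (0 : ℝ) ≤ Δ := Nat.cast_nonneg _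
  have h6 : C - degAt es u t ≠ 0 := by linarith
  have h7 : C - degAt es w t ≠ 0 := by linarith
  have h8 : C ≠ 0 := by linarith
  rw [h.testProb_eq ht]
  field_simp

/-- With `x = 0` this is the exactness of 1 - d/C under the recursion; the last factor isolates the
effect of the error `x` at the neighbor. -/
theorem one_sub_mul_one_sub {d : ℕ} (hΔ : (Δ : ℝ) + 4 ≤ C) (hd : d + 1 ≤ Δ) (x : ℝ) :
    (1 - d / C) * (1 - (1 + x) / (C - d)) =
      (1 - ((d + 1 : ℕ) : ℝ) / C) * (1 - x * (1 / (C - 1 - d))) := by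
  have h1 : (d : ℝ) + 1 ≤ Δ := by exact_mod_cast hd
  have h2 : (0 : ℝ) ≤ d := Nat.cast_nonneg _
  have h6 : C - d ≠ 0 := by linarith
  have h7 : C - 1 - d ≠ 0 := by linarith
  have h8 : C ≠ 0 := by linarith
  push_cast
  field_simp
  ring

theorem upperBound_of_lowerBound [Fintype V] (h : IsTreelike G es Δ g C e) {γ : ℝ}
    (hγ : Real.log C - Real.log (C - Δ) ≤ γ) {k : ℕ} {ε : ℝ} (hε : 0 ≤ ε)
    (hk : LowerBound G es Δ g C e k ε) :
    UpperBound G es Δ g C e (k + 1) (Real.exp (γ * ε) - 1) := by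
  intro j t u hu hj hd
  have hΔ := h.lt_param
  -- The exponent is kept in terms of the current degree so that each edge at `u` adds one
  -- telescoping term; only afterwards is it bounded by `γ * ε`.
  have key : freeProb C es (k + 1) t u ≤ Real.exp (ε * (Real.log (C - 1) -
      Real.log (C - 1 - degAt es u t))) * (1 - degAt es u t / C) := by
    induction t with
    | zero => simp [freeProb_zero_right, degAt]
    | succ t ih =>
      have ih := ih ((Nat.add_le_add_right (degAt_le_degAt_add_one t u) 1).trans hd)
      by_cases ht : ∃ w, es[t]? = some s(u, w)
      · obtain ⟨w, ht⟩ := ht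
        have ht' := ht.trans (congrArg some (Sym2.eq_swap (a := u) (b := w)))
        have hw := hk (j + 1) t w (edgeNeighborhood_adj (h.adj ht) hu) (by omega)
          (h.degAt_add_one_le ht')
        have hp := h.testProb_mem ht
        have hs1 := mul_le_one₀ hp.2 (freeProb_nonneg (C := C) (es := es) k t w)
          (freeProb_le_one k t w)
        have hs := mul_le_mul_of_nonneg_left hw hp.1
        rw [h.testProb_mul ht] at hs
        rw [h.freeProb_add_one hu hj ht]
        rw [degAt_add_one ht] at hd ⊢
        set d := degAt es u t
        set s := testProb C es s(u, w) * freeProb C es k t w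
        have hd' : (d : ℝ) + 2 ≤ Δ := by exact_mod_cast hd
        have hd0 : (0 : ℝ) ≤ d := Nat.cast_nonneg _
        have hlog := inv_le_log_sub_log (y := C - 1 - d) (by linarith)
        calc freeProb C es (k + 1) t u * (1 - s)
            ≤ (Real.exp (ε * (Real.log (C - 1) - Real.log (C - 1 - d))) * (1 - d / C)) * (1 - s) :=
              mul_le_mul_of_nonneg_right ih (by linarith)
          _ ≤ (Real.exp (ε * (Real.log (C - 1) - Real.log (C - 1 - d))) * (1 - d / C)) *
              (1 - (1 + -ε) / (C - d)) := by
              refine mul_le_mul_of_nonneg_left ?_ (mul_nonneg (Real.exp_pos _).le ?_)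
              · rw [← sub_eq_add_neg]; linarith
              · rw [sub_nonneg, div_le_one] <;> linarith
          _ = Real.exp (ε * (Real.log (C - 1) - Real.log (C - 1 - d))) *
              (1 - -ε * (1 / (C - 1 - d))) * (1 - ((d + 1 : ℕ) : ℝ) / C) := by
              rw [mul_assoc, one_sub_mul_one_sub hΔ (by omega)]; ring
          _ ≤ _ := by
              refine mul_le_mul_of_nonneg_right ?_ ?_
              · have h1 : 1 - -ε * (1 / (C - 1 - d)) ≤
                    Real.exp (ε * (Real.log (C - 1 - d) - Real.log (C - 1 - d - 1))) := by
                  refine le_trans ?_ (Real.add_one_le_exp _)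
                  have := mul_le_mul_of_nonneg_left hlog hε
                  linarith
                refine (mul_le_mul_of_nonneg_left h1 (Real.exp_pos _).le).trans ?_
                rw [← Real.exp_add]
                apply le_of_eq
                congr 1
                push_cast
                rw [show C - 1 - ((d : ℝ) + 1) = C - 1 - d - 1 by ring]
                ring
              · push_cast
                rw [sub_nonneg, div_le_one] <;> linarith
      · push Not at ht
        rwa [freeProb_add_one_of_ne ht, degAt_add_one_of_ne ht]
  refine key.trans ?_
  have hd' : (degAt es u t : ℝ) + 1 ≤ Δ := by exact_mod_cast hd
  have hd0 : (0 : ℝ) ≤ degAt es u t := Nat.cast_nonneg _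
  refine mul_le_mul_of_nonneg_right ?_ ?_
  · rw [add_sub_cancel, mul_comm γ]
    exact Real.exp_le_exp.2 (mul_le_mul_of_nonneg_left (log_sub_log_le hΔ hd hγ) hε)
  · rw [sub_nonneg, div_le_one] <;> linarith

/-- The factors 1 - η/(C-1-d) are bounded below by `exp_neg_le_one_sub`, whose second-order loss is
the correction 1 + η/(C-Δ). -/
theorem lowerBound_of_upperBound [Fintype V] (h : IsTreelike G es Δ g C e) {γ : ℝ}
    (hγ : Real.log C - Real.log (C - Δ) ≤ γ) {k : ℕ} {η : ℝ} (hη : 0 ≤ η) (hη2 : η ≤ 2)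
    (hk : UpperBound G es Δ g C e k η) :
    LowerBound G es Δ g C e (k + 1) (1 - Real.exp (-(γ * (η * (1 + η / (C - Δ)))))) := by
  intro j t u hu hj hd
  have hΔ := h.lt_param
  set ζ := η * (1 + η / (C - Δ)) with hζ
  have hCΔ : 0 < C - Δ := by linarith
  have hζ0 : 0 ≤ ζ := by positivity
  have key : Real.exp (-(ζ * (Real.log (C - 1) -
      Real.log (C - 1 - degAt es u t)))) * (1 - degAt es u t / C) ≤ freeProb C es (k + 1) t u := by
    induction t with
    | zero => simp [freeProb_zero_right, degAt]
    | succ t ih =>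
      have ih := ih ((Nat.add_le_add_right (degAt_le_degAt_add_one t u) 1).trans hd)
      by_cases ht : ∃ w, es[t]? = some s(u, w)
      · obtain ⟨w, ht⟩ := ht
        have ht' := ht.trans (congrArg some (Sym2.eq_swap (a := u) (b := w)))
        have hw := hk (j + 1) t w (edgeNeighborhood_adj (h.adj ht) hu) (by omega)
          (h.degAt_add_one_le ht')
        have hp := h.testProb_mem ht
        have hs1 := mul_le_one₀ hp.2 (freeProb_nonneg (C := C) (es := es) k t w)
          (freeProb_le_one k t w)
        have hs := mul_le_mul_of_nonneg_left hw hp.1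
        rw [h.testProb_mul ht] at hs
        rw [h.freeProb_add_one hu hj ht]
        rw [degAt_add_one ht] at hd ⊢
        set d := degAt es u t
        set s := testProb C es s(u, w) * freeProb C es k t w
        have hd' : (d : ℝ) + 2 ≤ Δ := by exact_mod_cast hd
        have hd0 : (0 : ℝ) ≤ d := Nat.cast_nonneg _
        have hlog := inv_le_log_sub_log (y := C - 1 - d) (by linarith)
        have hy : 0 < C - 1 - d := by linarith
        calc Real.exp (-(ζ * (Real.log (C - 1) - Real.log (C - 1 - ((d + 1 : ℕ) : ℝ))))) *
              (1 - ((d + 1 : ℕ) : ℝ) / C)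
            ≤ Real.exp (-(ζ * (Real.log (C - 1) - Real.log (C - 1 - d)))) *
              (1 - η * (1 / (C - 1 - d))) * (1 - ((d + 1 : ℕ) : ℝ) / C) := by
              refine mul_le_mul_of_nonneg_right ?_ ?_
              · have h1 : Real.exp (-(ζ * (Real.log (C - 1 - d) - Real.log (C - 1 - d - 1)))) ≤
                    1 - η * (1 / (C - 1 - d)) := by
                  refine le_trans ?_ (exp_neg_le_one_sub (x := η * (1 / (C - 1 - d)))
                    (by positivity) ?_)
                  · rw [Real.exp_le_exp, neg_le_neg_iff]
                    refine le_trans ?_ (mul_le_mul_of_nonneg_left hlog hζ0)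
                    have : η * (1 / (C - 1 - d)) ≤ η / (C - Δ) := by
                      rw [mul_one_div]
                      exact div_le_div_of_nonneg_left hη hCΔ (by linarith)
                    rw [hζ]
                    calc η * (1 / (C - 1 - d)) * (1 + η * (1 / (C - 1 - d)))
                        ≤ η * (1 / (C - 1 - d)) * (1 + η / (C - Δ)) :=
                          mul_le_mul_of_nonneg_left (by linarith) (by positivity)
                      _ = _ := by ring
                  -- Here `η ≤ 2` and C - 1 - d ≥ 4, so the argument is at most 1/2.
                  · rw [mul_one_div, div_le_iff₀ hy]
                    linarith
                refine le_trans ?_ (mul_le_mul_of_nonneg_left h1 (Real.exp_pos _).le)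
                rw [← Real.exp_add]
                apply le_of_eq
                congr 1
                push_cast
                rw [show C - 1 - ((d : ℝ) + 1) = C - 1 - d - 1 by ring]
                ring
              · push_cast
                rw [sub_nonneg, div_le_one] <;> linarith
          _ = (Real.exp (-(ζ * (Real.log (C - 1) - Real.log (C - 1 - d)))) * (1 - d / C)) *
              (1 - (1 + η) / (C - d)) := by
              rw [mul_assoc _ (1 - d / C), one_sub_mul_one_sub hΔ (by omega)]; ring
          _ ≤ (Real.exp (-(ζ * (Real.log (C - 1) - Real.log (C - 1 - d)))) * (1 - d / C)) *
              (1 - s) := by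
              refine mul_le_mul_of_nonneg_left ?_ (mul_nonneg (Real.exp_pos _).le ?_)
              · linarith
              · rw [sub_nonneg, div_le_one] <;> linarith
          _ ≤ freeProb C es (k + 1) t u * (1 - s) :=
              mul_le_mul_of_nonneg_right ih (by linarith)
      · push Not at ht
        rwa [freeProb_add_one_of_ne ht, degAt_add_one_of_ne ht]
  refine le_trans ?_ key
  have hd' : (degAt es u t : ℝ) + 1 ≤ Δ := by exact_mod_cast hd
  have hd0 : (0 : ℝ) ≤ degAt es u t := Nat.cast_nonneg _
  refine mul_le_mul_of_nonneg_right ?_ ?_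
  · rw [sub_sub_cancel, mul_comm γ]
    exact Real.exp_le_exp.2 (neg_le_neg (mul_le_mul_of_nonneg_left (log_sub_log_le hΔ hd hγ) hζ0))
  · rw [sub_nonneg, div_le_one] <;> linarith

end IsTreelike

end

/-! ### Contraction of the error and its iteration -/

/-- The numerical consequences of the assumption on the parameter `C`. -/
theorem param_bounds {x δ C : ℝ} (hδ0 : 0 < δ) (hδ1 : δ < 1 / 20) (hx : 25 ≤ x)
    (hC : (Real.exp 1 / (Real.exp 1 - 1) + δ) * x < C) :
    x + 4 ≤ C ∧ C ≤ (C - x) ^ 2 ∧ C ≤ 3 * (C - x) ∧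
      Real.log C - Real.log (C - x) ≤ 1 - δ / 4 := by
  have hE1 := Real.exp_one_gt_d9
  have hE2 := Real.exp_one_lt_d9
  have hexp : Real.exp 1 * (1 - δ / 4) ≤ Real.exp (1 - δ / 4) := by
    rw [sub_eq_add_neg 1 (δ / 4), Real.exp_add]
    refine mul_le_mul_of_nonneg_left ?_ (Real.exp_pos 1).le
    linarith [Real.add_one_le_exp (-(δ / 4))]
  set E := Real.exp 1
  have hb : E / (E - 1) * (E - 1) = E := div_mul_cancel₀ _ (by linarith)
  have hb1 : 1.58 ≤ E / (E - 1) := by rw [le_div_iff₀ (by linarith)]; linarith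
  have hb2 : E / (E - 1) ≤ 1.6 := by rw [div_le_iff₀ (by linarith)]; linarith
  set b := E / (E - 1)
  have hC1 : 1.58 * x ≤ C := by nlinarith
  refine ⟨by linarith, by nlinarith, by linarith, ?_⟩
  rw [← Real.log_div (by linarith) (by linarith),
    Real.log_le_iff_le_exp (div_pos (by linarith) (by linarith))]
  refine le_trans ?_ hexp
  rw [div_le_iff₀ (by linarith)]
  have h1 : 0 ≤ (E - 1) + E / 4 - E * b / 4 - E * δ / 4 := by nlinarith
  -- Equality holds at δ = 0 because b (E - 1) = E; `h1` says that the remaining terms, which carry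
  -- a factor δ, are favorable.
  have h2 : E * (1 - δ / 4) ≤ (b + δ) * (E * (1 - δ / 4) - 1) := by
    have : (b + δ) * (E * (1 - δ / 4) - 1) - E * (1 - δ / 4) =
        (b * (E - 1) - E) + δ * ((E - 1) + E / 4 - E * b / 4 - E * δ / 4) := by ring
    have := mul_nonneg hδ0.le h1
    linarith
  have h3 : 0 ≤ E * (1 - δ / 4) - 1 := by nlinarith
  have h4 := mul_le_mul_of_nonneg_right hC.le h3
  have h5 := mul_le_mul_of_nonneg_right h2 (by linarith : (0 : ℝ) ≤ x)
  linarith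

/-- One `κ` is given up as `κ ≤ 1`; the other one, inside η = exp(κε) - 1, survives through exp(-η)
≥ 1 - κε. The quadratic term costs η²/D ≤ 4/D since η ≤ 2. -/
theorem one_sub_exp_le {κ ε D : ℝ} (hκ0 : 0 ≤ κ) (hκ1 : κ ≤ 1) (hε0 : 0 ≤ ε) (hε1 : ε ≤ 1)
    (hD : 0 < D) :
    1 - Real.exp (-(κ * ((Real.exp (κ * ε) - 1) * (1 + (Real.exp (κ * ε) - 1) / D)))) ≤
      κ * ε + 4 / D := by
  have h0 : 0 ≤ κ * ε := by positivity
  have h1 : κ * ε ≤ 1 := mul_le_one₀ hκ1 hε0 hε1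
  have hη := one_sub_le_exp_one_sub_exp h0
  have hη0 : 0 ≤ Real.exp (κ * ε) - 1 := by linarith [Real.add_one_le_exp (κ * ε)]
  have hη2 : Real.exp (κ * ε) - 1 ≤ 2 := by
    linarith [Real.exp_le_exp.2 h1, Real.exp_one_lt_d9]
  set η := Real.exp (κ * ε) - 1
  have h2 : η ^ 2 / D ≤ 4 / D := div_le_div_of_nonneg_right (by nlinarith) hD.le
  have h3 : Real.exp (-η) * Real.exp (-(η ^ 2 / D)) ≤
      Real.exp (-(κ * (η * (1 + η / D)))) := by
    rw [← Real.exp_add, Real.exp_le_exp]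
    have : κ * (η * (1 + η / D)) ≤ 1 * (η * (1 + η / D)) :=
      mul_le_mul_of_nonneg_right hκ1 (by positivity)
    calc -η + -(η ^ 2 / D) = -(1 * (η * (1 + η / D))) := by ring
      _ ≤ _ := neg_le_neg this
  have h4 := Real.add_one_le_exp (-(η ^ 2 / D))
  have h5 : Real.exp (-η) ≤ 1 := Real.exp_le_one_iff.2 (by linarith)
  have h6 : 0 ≤ η ^ 2 / D := by positivity
  nlinarith [Real.exp_pos (-η)]

section
variable {V : Type*} [DecidableEq V] {G : SimpleGraph V} {es : List (Sym2 V)}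
  {Δ g : ℕ} {C : ℝ} {e : Sym2 V}

namespace IsTreelike

theorem one_sub_degAt_div_nonneg (h : IsTreelike G es Δ g C e) {t : ℕ} {u : V}
    (hd : degAt es u t + 1 ≤ Δ) : 0 ≤ 1 - degAt es u t / C := by
  have hΔ := h.lt_param
  have h0 : (0 : ℝ) ≤ Δ := Nat.cast_nonneg _
  have := le_sub_degAt (C := C) hd
  rw [sub_nonneg, div_le_one] <;> linarith

theorem lowerBound_mono [Fintype V] (h : IsTreelike G es Δ g C e) {k : ℕ} {ε ε' : ℝ}
    (hε : ε ≤ ε') (hk : LowerBound G es Δ g C e k ε) : LowerBound G es Δ g C e k ε' :=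
  fun j t u hu hj hd => le_trans (mul_le_mul_of_nonneg_right (by linarith)
    (h.one_sub_degAt_div_nonneg hd)) (hk j t u hu hj hd)

theorem lowerBound_one [Fintype V] (k : ℕ) : LowerBound G es Δ g C e k 1 := by
  intro j t u _ _ _
  rw [sub_self, zero_mul]
  exact freeProb_nonneg k t u

theorem lowerBound_add_two [Fintype V] (h : IsTreelike G es Δ g C e) {κ : ℝ} (hκ0 : 0 ≤ κ)
    (hκ1 : κ ≤ 1) (hκ : Real.log C - Real.log (C - Δ) ≤ κ) {k : ℕ} {ε : ℝ} (hε0 : 0 ≤ ε)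
    (hε1 : ε ≤ 1) (hk : LowerBound G es Δ g C e k ε) :
    LowerBound G es Δ g C e (k + 2) (κ * ε + 4 / (C - Δ)) := by
  have hΔ := h.lt_param
  have h0 : 0 ≤ κ * ε := by positivity
  have h1 : κ * ε ≤ 1 := mul_le_one₀ hκ1 hε0 hε1
  refine h.lowerBound_mono (one_sub_exp_le hκ0 hκ1 hε0 hε1 (by linarith))
    (h.lowerBound_of_upperBound hκ ?_ ?_ (h.upperBound_of_lowerBound hκ hε0 hk))
  · linarith [Real.add_one_le_exp (κ * ε)]
  · linarith [Real.exp_le_exp.2 h1, Real.exp_one_lt_d9]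

theorem lowerBound_two_mul [Fintype V] (h : IsTreelike G es Δ g C e) {δ : ℝ} (hδ0 : 0 < δ)
    (hδ1 : δ < 1 / 20) (hC : C ≤ 3 * (C - Δ))
    (hκ : Real.log C - Real.log (C - Δ) ≤ 1 - δ / 4) (k : ℕ) :
    LowerBound G es Δ g C e (2 * k) (min 1 ((1 - δ / 4) ^ k + 10 ^ 4 / (δ * C))) := by
  have hΔ := h.lt_param
  have hΔ0 : (0 : ℝ) ≤ Δ := Nat.cast_nonneg _
  have hC0 : 0 < C := by linarith
  -- The generous 2500 makes 10^4/(δC) the exact fixed point of x ↦ (1 - δ/4) x + 2500/C.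
  have hD : 4 / (C - Δ) ≤ 2500 / C := by
    rw [div_le_div_iff₀ (by linarith) hC0]
    linarith
  have herr : 0 < 10 ^ 4 / (δ * C) := by positivity
  induction k with
  | zero =>
    -- At depth 0 the deficit is 1, a vacuous bound; the cap at 1 also supplies the `ε ≤ 1` needed
    -- at each double step.
    rw [min_eq_left (by rw [pow_zero]; linarith)]
    exact lowerBound_one 0
  | succ k ih =>
    rcases min_choice 1 ((1 - δ / 4) ^ (k + 1) + 10 ^ 4 / (δ * C)) with hm | hm
    · rw [hm]
      exact lowerBound_one _
    · rw [hm]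
      have hpow : 0 ≤ (1 - δ / 4) ^ k := pow_nonneg (by linarith) k
      refine h.lowerBound_mono ?_ (h.lowerBound_add_two (by linarith) (by linarith) hκ
        (le_min zero_le_one (by linarith)) (min_le_left _ _) ih)
      have h1 := mul_le_mul_of_nonneg_left
        (min_le_right 1 ((1 - δ / 4) ^ k + 10 ^ 4 / (δ * C))) (by linarith : 0 ≤ 1 - δ / 4)
      have h2 : (1 - δ / 4) * ((1 - δ / 4) ^ k + 10 ^ 4 / (δ * C)) + 2500 / C =
          (1 - δ / 4) ^ (k + 1) + 10 ^ 4 / (δ * C) := by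
        field_simp
        ring
      linarith

end IsTreelike

end
theorem countP_le_degree {V : Type*} [Fintype V] [DecidableEq V]
    (G : SimpleGraph V) [DecidableRel G.Adj] {es : List (Sym2 V)} (hnodup : es.Nodup)
    (hes : ∀ f, f ∈ es ↔ f ∈ G.edgeSet) (u : V) :
    es.countP (fun f => u ∈ f) ≤ G.degree u := by
  rw [List.countP_eq_length_filter, ← List.toFinset_card_of_nodup (hnodup.filter _),
    ← G.card_incidenceFinset_eq_degree]
  refine Finset.card_le_card fun f hf => ?_
  simp only [List.mem_toFinset, List.mem_filter, decide_eq_true_eq] at hf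
  rw [SimpleGraph.mem_incidenceFinset]
  exact ⟨(hes f).1 hf.1, hf.2⟩

end OnlineMatching

theorem mainTheorem3 {V : Type*} [Fintype V] [DecidableEq V]
    (G : SimpleGraph V) [DecidableRel G.Adj]
    (es : List (Sym2 V)) (hnodup : es.Nodup) (hes : ∀ f, f ∈ es ↔ f ∈ G.edgeSet)
    (Δ g : ℕ) (δ C : ℝ) (hδ0 : 0 < δ) (hδ1 : δ < 1 / 20) (hΔ : 25 ≤ Δ)
    (hG : G.maxDegree ≤ Δ)
    (hC : (Real.exp 1 / (Real.exp 1 - 1) + δ) * (Δ : ℝ) < C)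
    (e : Sym2 V) (he : e ∈ G.edgeSet)
    (hcycle : (G.induce (OnlineMatching.edgeNeighborhood G g e)).IsAcyclic) :
    1 / C * (max 0 (1 - (1 - δ / 4) ^ (((g : ℝ) - 1) / 2) - 10 ^ 4 / (δ * C))) ^ 2
      ≤ OnlineMatching.matchProb C es e := by
  open OnlineMatching in
  obtain ⟨hC1, hC2, hC3, hκ⟩ := param_bounds hδ0 hδ1 (by exact_mod_cast hΔ) hC
  have h : IsTreelike G es Δ g C e := ⟨hnodup, hes, fun u =>
    (countP_le_degree G hnodup hes u).trans ((G.degree_le_maxDegree u).trans hG), hC1, hC2, hcycle⟩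
  obtain ⟨t, ht⟩ := List.mem_iff_getElem?.1 ((hes e).2 he)
  induction e using Sym2.ind with | _ u w =>
  have ht' := ht.trans (congrArg some (Sym2.eq_swap (a := u) (b := w)))
  have hd := h.degAt_add_one_le ht
  have hd' := h.degAt_add_one_le ht'
  have hu := h.one_sub_degAt_div_nonneg hd
  have hg : 2 * (g / 2) ≤ g := Nat.mul_div_le g 2
  have hlow := h.lowerBound_two_mul hδ0 hδ1 hC3 hκ (g / 2)
  -- The left exponent is the floor of g/2, which is at least (g - 1)/2; the base is below 1.
  have hpow : (1 - δ / 4) ^ (g / 2) ≤ (1 - δ / 4) ^ (((g : ℝ) - 1) / 2) := by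
    rw [← Real.rpow_natCast]
    refine Real.rpow_le_rpow_of_exponent_ge (by linarith) (by linarith) ?_
    have : (g : ℝ) ≤ 2 * ((g / 2 : ℕ) : ℝ) + 1 := by
      exact_mod_cast (by omega : g ≤ 2 * (g / 2) + 1)
    linarith
  set m := max 0 (1 - (1 - δ / 4) ^ (((g : ℝ) - 1) / 2) - 10 ^ 4 / (δ * C)) with hm
  have hm0 : 0 ≤ m := le_max_left _ _
  have hlow' : LowerBound G es Δ g C s(u, w) (2 * (g / 2)) (1 - m) := by
    refine h.lowerBound_mono ?_ hlow
    rw [le_sub_comm, hm]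
    refine max_le ?_ ?_
    · linarith [min_le_left 1 ((1 - δ / 4) ^ (g / 2) + 10 ^ 4 / (δ * C))]
    · linarith [min_le_right 1 ((1 - δ / 4) ^ (g / 2) + 10 ^ 4 / (δ * C))]
  have h1 := hlow' 0 t u (mem_edgeNeighborhood_zero (by simp)) (by omega) hd
  have h2 := hlow' 0 t w (mem_edgeNeighborhood_zero (by simp)) (by omega) hd'
  rw [sub_sub_cancel] at h1 h2
  refine le_trans (le_of_eq ?_) ((mul_le_mul_of_nonneg_left (mul_le_mul h1 h2
    (mul_nonneg hm0 (h.one_sub_degAt_div_nonneg hd')) (freeProb_nonneg _ _ _))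
    (h.testProb_mem ht).1).trans (h.le_matchProb hg ht rfl))
  -- `testProb_mul` cancels the degree of `w`, leaving m (1 - d_u/C) m / (C - d_u) = m²/C.
  rw [← mul_assoc (m * (1 - degAt es u t / C)) m, h.testProb_mul ht]
  have hx := le_sub_degAt (C := C) hd
  have h6 : C - degAt es u t ≠ 0 := by linarith
  have h8 : C ≠ 0 := by
    have : (0 : ℝ) ≤ Δ := Nat.cast_nonneg _
    linarith
  field_simp
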